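/- All Hilbert spaces are finite-dimensional and $\log=\log_2$. Let $\mathcal{H}_N$ be a Hilbert space of dimension $|N|$ with standard orthonormal basis $\{|n\rangle\}$, put $n=\log|N|$, and suppose that a full set of $|N|+1$ mutually unbiased bases $\{|\theta_i\rangle\}_{i}$, $\theta\in\{1,\dots,|N|+1\}$, of $\mathcal{H}_N$ is given (that is, orthonormal bases with $|\langle\theta_i|\theta'_{i'}\rangle|=1/\sqrt{|N|}$ whenever $\theta\neq\theta'$). Let $U^\theta$ be the unitary that maps the $\theta$-th of these bases to the standard basis. Let $\mathcal{P}=\{P^j\}_{j\in J}$ be a non-empty finite family, $|\mathcal{P}|=|J|$, of permutations of the standard basis labels that is pairwise independent, i.e. for all $x_1\neq x_2$ and $y_1\neq y_2$ and uniformly random $j$, $\Pr\{P^j(x_1)=y_1,\ P^j(x_2)=y_2\}=\frac{1}{|N|(|N|-1)}$; the permutation $P^j$ also denotes the unitary $|n\rangle\mapsto|P^j(n)\rangle$. For states, let $H_{\min}(N|R)_\rho=-\inf_{\sigma_R}\inf\{\mu\in\mathbb{R}:\rho_{NR}\le 2^\mu\,1_N\otimes\sigma_R\}$, with $\sigma_R$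 ranging over the density matrices on $R$. Split the standard basis of $\mathcal{H}_N$ as $\{|mm'\rangle\}$, i.e. identify its labels with pairs $(m,m')$ from two finite sets of sizes $|M|$ and $|M'|$, and let $\mathcal{T}_{N\to M}(\cdot)=\sum_{m,m'}\langle mm'|\cdot|mm'\rangle\,|m\rangle\langle m|_M$. A finite family of unitaries $\{V^i\}_{i\in D}$ on $\mathcal{H}_N$ is a strong $(k,\varepsilon)$ quantum-classical min-entropy extractor against quantum side information, with output size $\log|M|$ and seed size $\log|D|$, if for every finite-dimensional $\mathcal{H}_R$ and every density matrix $\rho_{NR}$ with $H_{\min}(N|R)_\rho\ge k$, $$\Big\|\frac1{|D|}\sum_{i\in D}\mathcal{T}_{N\to M}\big(V^i\rho_{NR}(V^i)^\dagger\big)\otimes|i\rangle\langle i|_D-\frac{1_M}{|M|}\otimes\rho_R\otimes\frac{1_D}{|D|}\Big\|_1\le\varepsilon .$$ Theorem. Let $k\in[-n,n]$ and $\varepsilon>0$, and let the output size $m=\log|M|$ satisfy $$m\le\min\Big\{n,\;n+k-2\log\frac1\varepsilon-2\Big\}.$$ Then the family $\{P^jU^\theta\}_{j\in J,\ 1\le\theta\le|N|+1}$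 is a strong $(k,\varepsilon)$ quantum-classical min-entropy extractor against quantum side information with output size $m$, and its seed size is $d=\log|\mathcal{P}|+\log(|N|+1)$. In particular, whenever the set of standard basis labels carries the structure of a field, the family $\{x\mapsto a x+b:\ a\neq0,\ b\}$ of affine permutations is pairwise independent, and with this family in place of $\mathcal{P}$ one obtains such an extractor with seed size at most $3n$. -/

import Mathlib

open scoped Kronecker ComplexOrder

namespace QCExtractor

/-- The number of (qu)bits of a finite register or of a Hilbert space with orthonormal basis
indexed by `S`, i.e. `log₂ |S|`. -/
noncomputable def bits (S : Type*) [Fintype S] : ℝ := Real.logb 2 (Fintype.card S)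

/-- The set of (normalized) density matrices on the Hilbert space with orthonormal basis `S`. -/
def States (S : Type*) [Fintype S] : Set (Matrix S S ℂ) :=
  {ρ | ρ.PosSemidef ∧ ρ.trace = 1}

/-- The trace norm: the sum of the singular values. -/
noncomputable def traceNorm {S : Type*} [Fintype S] [DecidableEq S] (X : Matrix S S ℂ) : ℝ :=
  ∑ i, √((Matrix.isHermitian_conjTranspose_mul_self X).eigenvalues i)

/-- The marginal `ρ_R` of an operator `ρ_{NR}`. -/
def marginalRight {N R : Type*} [Fintype N] (ρ : Matrix (N × R) (N × R) ℂ) : Matrix R R ℂ :=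
  Matrix.of fun r s => ∑ n, ρ (n, r) (n, s)

/-- The max-relative entropy `D_max(ρ‖σ) = inf {μ : ρ ≤ 2^μ σ}`, with `inf ∅ = ∞`. -/
noncomputable def Dmax {S : Type*} [Fintype S] (ρ σ : Matrix S S ℂ) : EReal :=
  sInf ((fun μ : ℝ => (μ : EReal)) ''
    {μ : ℝ | ((((2 : ℝ) ^ μ : ℝ) : ℂ) • σ - ρ).PosSemidef})

/-- The conditional min-entropy
`H_min(N|R)_ρ = - inf_σ D_max(ρ_{NR} ‖ 1_N ⊗ σ_R)`, over the states `σ_R` of `R`. -/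
noncomputable def Hmin {N R : Type*} [Fintype N] [DecidableEq N] [Fintype R]
    (ρ : Matrix (N × R) (N × R) ℂ) : EReal :=
  -(⨅ σ ∈ States R, Dmax ρ ((1 : Matrix N N ℂ) ⊗ₖ σ))

/-- The measurement map `T_{N → M}`, extended by the identity of `R`. The standard basis of `N`
is split as `|m m'⟩` by `e`; the operator `X_{NR}` is mapped to
`∑_{m m'} |m⟩⟨m| ⊗ ⟨m m'| X_{NR} |m m'⟩`. -/
def measure {N M M' R : Type*} [Fintype M'] [DecidableEq M] (e : N ≃ M × M')
    (X : Matrix (N × R) (N × R) ℂ) : Matrix (M × R) (M × R) ℂ :=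
  Matrix.of fun a b =>
    if a.1 = b.1 then ∑ m' : M', X (e.symm (a.1, m'), a.2) (e.symm (a.1, m'), b.2) else 0

/-- The operator `U_N ρ_{NR} U_N†`. -/
def conjugate {N R : Type*} [Fintype N] [DecidableEq N] [Fintype R] [DecidableEq R]
    (U : Matrix N N ℂ) (ρ : Matrix (N × R) (N × R) ℂ) : Matrix (N × R) (N × R) ℂ :=
  (U ⊗ₖ (1 : Matrix R R ℂ)) * ρ * (U ⊗ₖ (1 : Matrix R R ℂ)).conjTranspose

/-- The output `(1/|D|) ∑_i T_{N → M}(U^i ρ_{NR} (U^i)†) ⊗ |i⟩⟨i|_D`. -/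
noncomputable def realOutput {N M M' D R : Type*} [Fintype N] [DecidableEq N]
    [DecidableEq M] [Fintype M'] [Fintype D] [DecidableEq D] [Fintype R] [DecidableEq R]
    (e : N ≃ M × M') (U : D → Matrix.unitaryGroup N ℂ) (ρ : Matrix (N × R) (N × R) ℂ) :
    Matrix ((M × R) × D) ((M × R) × D) ℂ :=
  (Fintype.card D : ℂ)⁻¹ •
    ∑ i : D, measure e (conjugate (U i : Matrix N N ℂ) ρ) ⊗ₖ Matrix.single i i (1 : ℂ)

/-- The ideal output `1_M/|M| ⊗ ρ_R ⊗ 1_D/|D|`. -/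
noncomputable def idealOutput {N : Type*} (M D : Type*) {R : Type*} [Fintype N]
    [Fintype M] [DecidableEq M] [Fintype D] [DecidableEq D] (ρ : Matrix (N × R) (N × R) ℂ) :
    Matrix ((M × R) × D) ((M × R) × D) ℂ :=
  (((Fintype.card M : ℂ)⁻¹ • (1 : Matrix M M ℂ)) ⊗ₖ marginalRight ρ) ⊗ₖ
    ((Fintype.card D : ℂ)⁻¹ • (1 : Matrix D D ℂ))

/-- A family of unitaries on `N`, indexed by the seed register `D`, is a strong `(k, ε)`
quantum-classical min-entropy extractor against quantum side information, with output register
`M`. The side information `R` ranges over all finite-dimensional systems. -/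
def IsStrongQCExtractor {N M M' D : Type*} [Fintype N] [DecidableEq N]
    [Fintype M] [DecidableEq M] [Fintype M'] [Fintype D] [DecidableEq D]
    (e : N ≃ M × M') (k ε : ℝ) (U : D → Matrix.unitaryGroup N ℂ) : Prop :=
  ∀ (R : Type) [Fintype R] [DecidableEq R], ∀ ρ ∈ States (N × R), (k : EReal) ≤ Hmin ρ →
    traceNorm (realOutput e U ρ - idealOutput M D ρ) ≤ ε

/-- A family of orthonormal bases of `ℂ^N` is mutually unbiased. -/
def MutuallyUnbiased {N Θ : Type*} [Fintype N]
    (b : Θ → OrthonormalBasis N ℂ (EuclideanSpace ℂ N)) : Prop :=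
  ∀ θ θ' : Θ, θ ≠ θ' → ∀ k k' : N,
    ‖inner ℂ (b θ k) (b θ' k')‖ = 1 / √(Fintype.card N : ℝ)

/-- A family of permutations of `X`, indexed by `J`, is pairwise independent: for a uniformly
random `j`, the pair `(P j x₁, P j x₂)` takes each value `(y₁, y₂)` with `y₁ ≠ y₂` with
probability `1 / (|X| (|X| - 1))`. -/
def PairwiseIndependent {X J : Type*} [Fintype X] [DecidableEq X] [Fintype J]
    (P : J → Equiv.Perm X) : Prop :=
  ∀ x₁ x₂ y₁ y₂ : X, x₁ ≠ x₂ → y₁ ≠ y₂ →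
    ((Finset.univ.filter fun j => P j x₁ = y₁ ∧ P j x₂ = y₂).card : ℝ) / Fintype.card J =
      1 / ((Fintype.card X : ℝ) * ((Fintype.card X : ℝ) - 1))

/-- The matrix of the linear map `|n⟩ ↦ |π(n)⟩`. -/
def permMatrix {N : Type*} [DecidableEq N] (π : Equiv.Perm N) : Matrix N N ℂ :=
  Matrix.of fun i n => if i = π n then 1 else 0

theorem permMatrix_mem {N : Type*} [Fintype N] [DecidableEq N] (π : Equiv.Perm N) :
    permMatrix π ∈ Matrix.unitaryGroup N ℂ := by
  rw [Matrix.mem_unitaryGroup_iff']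
  ext i j
  simp [permMatrix, Matrix.mul_apply, Matrix.star_apply, Matrix.one_apply, eq_comm]

/-- The unitary `|n⟩ ↦ |π(n)⟩`. -/
def permUnitary {N : Type*} [Fintype N] [DecidableEq N] (π : Equiv.Perm N) :
    Matrix.unitaryGroup N ℂ :=
  ⟨permMatrix π, permMatrix_mem π⟩

/-- The permutation `x ↦ a x + b` of a field, for `a ≠ 0`. -/
def affinePerm {F : Type*} [Field F] (p : Fˣ × F) : Equiv.Perm F :=
  (Units.mulLeft p.1).trans (Equiv.addRight p.2)

end QCExtractor

/-!
The trace norm is controlled by Hölder's inequality `‖S Y‖₁ ≤ ‖S‖₂ ‖Y‖₂`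
(`traceNorm_mul_sq_le`). The bound `H_min(N|R)_ρ ≥ k` provides an operator `ω = S S†` on `R` with
`ρ ≤ 1 ⊗ ω`, `ω` positive definite, and `tr ω ≤ 4 · 2^(-k)` (`exists_dominating_of_le_Hmin`). Put
`Y = (1 ⊗ S⁻¹) ρ`. Then `‖Y‖₂² = tr (ρ (1 ⊗ ω)⁻¹ ρ) ≤ tr ρ = 1` by a Schur complement argument
(`hsSq_inv_mul_le`), and since multiplication by `S` on `R` commutes with every operation of the
extractor, the deviation of its output from the ideal one is `1_M ⊗ S ⊗ 1_D` times the deviation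
computed for `Y` (`realOutput_sub_idealOutput_one_kronecker_mul`). Only the one-sided factor `S⁻¹`
is needed, so no roots of `ω` beyond a factorization enter.

The Hilbert–Schmidt norm of the deviation for `Y` splits into the blocks `A = ⟨r| Y |s⟩`, which are
plain matrices on `N`, and `sum_norm_sub_uniform_sq_le` bounds each of them:
* For a function with sum zero, a pairwise independent family of permutations makes the mean
  squared sum over the fibres `{(m, m') : m'}` at most the sum of squares, because distinct points
  collide with equal probability and hence contribute a non-positive amount
  (`PairwiseIndependent.sum_norm_fiber_sq_le`).
* The traceless parts of the projectors of mutually unbiased bases are orthogonal for different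
  bases, so `∑_θ ∑_x |⟨θ_x| B |θ_x⟩|² ≤ ‖B‖₂²` for traceless `B`, which is Bessel's inequality
  (`sum_norm_diag_sq_le_hsSq`). Averaging over the `|N| + 1` bases gains the factor
  `1 / (|N| + 1)`.

Altogether the squared trace norm is at most `|M| · 4 · 2^(-k) / (|N| + 1) ≤ ε²`.
-/

namespace QCExtractor

open Matrix

/-! ### Hilbert–Schmidt norm and trace norm -/

/-- The square of the Hilbert–Schmidt norm. -/
noncomputable def hsSq {m n : Type*} [Fintype m] [Fintype n] (A : Matrix m n ℂ) : ℝ :=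
  ∑ i, ∑ j, ‖A i j‖ ^ 2

theorem hsSq_nonneg {m n : Type*} [Fintype m] [Fintype n] (A : Matrix m n ℂ) : 0 ≤ hsSq A := by
  unfold hsSq; positivity

theorem trace_conjTranspose_mul_self_eq {m n : Type*} [Fintype m] [Fintype n]
    (A : Matrix m n ℂ) : (Aᴴ * A).trace = (hsSq A : ℂ) := by
  simp only [hsSq, Matrix.trace, Matrix.diag, Matrix.mul_apply, Matrix.conjTranspose_apply]
  rw [Finset.sum_comm]
  push_cast
  refine Finset.sum_congr rfl fun i _ => Finset.sum_congr rfl fun j _ => ?_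
  rw [← Complex.conj_mul']; rfl

theorem hsSq_conjTranspose {m n : Type*} [Fintype m] [Fintype n] (A : Matrix m n ℂ) :
    hsSq Aᴴ = hsSq A := by
  unfold hsSq
  rw [Finset.sum_comm]
  simp [Matrix.conjTranspose_apply]

/-- The Cauchy–Schwarz inequality for the Hilbert–Schmidt inner product. -/
theorem norm_trace_mul_sq_le {m n : Type*} [Fintype m] [Fintype n]
    (A : Matrix m n ℂ) (B : Matrix n m ℂ) : ‖(A * B).trace‖ ^ 2 ≤ hsSq A * hsSq B := by
  have h1 : ‖(A * B).trace‖ ≤ ∑ p : m × n, ‖A p.1 p.2‖ * ‖B p.2 p.1‖ := by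
    simp only [Matrix.trace, Matrix.diag, Matrix.mul_apply]
    rw [← Fintype.sum_prod_type' (f := fun i j => A i j * B j i)]
    refine (norm_sum_le _ _).trans (le_of_eq ?_)
    simp
  have h2 : hsSq A = ∑ p : m × n, ‖A p.1 p.2‖ ^ 2 := by
    rw [hsSq, Fintype.sum_prod_type]
  have h3 : hsSq B = ∑ p : m × n, ‖B p.2 p.1‖ ^ 2 := by
    rw [hsSq, Fintype.sum_prod_type, Finset.sum_comm]
  rw [h2, h3]
  refine le_trans (pow_le_pow_left₀ (norm_nonneg _) h1 2) ?_
  exact Finset.sum_mul_sq_le_sq_mul_sq _ _ _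

/-- Hölder's inequality `‖S Y‖₁ ≤ ‖S‖₂ ‖Y‖₂` for the trace norm, in squared form. -/
theorem traceNorm_mul_sq_le {n : Type*} [Fintype n] [DecidableEq n] (S Y : Matrix n n ℂ) :
    traceNorm (S * Y) ^ 2 ≤ hsSq S * hsSq Y := by
  set X := S * Y with hX
  have hH := Matrix.isHermitian_conjTranspose_mul_self X
  set V : Matrix n n ℂ := (hH.eigenvectorUnitary : Matrix n n ℂ) with hV
  have hVV : Vᴴ * V = 1 := Unitary.coe_star_mul_self hH.eigenvectorUnitary
  have hVV' : V * Vᴴ = 1 := Unitary.coe_mul_star_self hH.eigenvectorUnitary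
  set l := hH.eigenvalues with hl
  have hl0 : ∀ i, 0 ≤ l i := (Matrix.posSemidef_conjTranspose_mul_self X).eigenvalues_nonneg
  have hspec : Vᴴ * (Xᴴ * X) * V = diagonal (fun i => (l i : ℂ)) := by
    have := hH.conjStarAlgAut_star_eigenvectorUnitary
    rw [Unitary.conjStarAlgAut_star_apply] at this
    exact this
  -- `W` holds the left singular vectors, and zero columns for the vanishing singular values.
  set s : n → ℂ := fun i => ((√(l i))⁻¹ : ℝ) with hs
  set W := X * V * diagonal s with hW
  have hss : star s = s := by ext i; simp [hs]
  have hWW : Wᴴ * W = diagonal (fun i => if l i = 0 then 0 else 1) := by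
    have : Wᴴ * W = diagonal s * (Vᴴ * (Xᴴ * X) * V) * diagonal s := by
      simp only [hW, conjTranspose_mul, diagonal_conjTranspose, hss, Matrix.mul_assoc]
    rw [this, hspec, diagonal_mul_diagonal, diagonal_mul_diagonal]
    congr 1; ext i
    simp only [hs]
    split_ifs with h
    · simp [h]
    · have : √(l i) ≠ 0 := (Real.sqrt_pos.2 (lt_of_le_of_ne (hl0 i) (Ne.symm h))).ne'
      norm_cast
      rw [← Real.mul_self_sqrt (hl0 i)]
      simp only [Real.sqrt_mul_self (Real.sqrt_nonneg _)]
      field_simp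
  have hWd : W * (Wᴴ * W) = W := by
    rw [hWW, hW, Matrix.mul_assoc (X * V), diagonal_mul_diagonal]
    congr 2; ext i
    simp only [hs]
    split_ifs with h <;> simp [h]
  have hWX : (Wᴴ * X * V).trace = ((∑ i, √(l i) : ℝ) : ℂ) := by
    have : Wᴴ * X * V = diagonal s * (Vᴴ * (Xᴴ * X) * V) := by
      simp only [hW, conjTranspose_mul, diagonal_conjTranspose, hss, Matrix.mul_assoc]
    rw [this, hspec, diagonal_mul_diagonal, trace_diagonal]
    push_cast
    refine Finset.sum_congr rfl fun i _ => ?_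
    simp only [hs]
    norm_cast
    by_cases h : √(l i) = 0
    · simp [h]
    · nth_rewrite 2 [← Real.mul_self_sqrt (hl0 i)]
      field_simp
  -- `W Wᴴ` is an orthogonal projection, and `key` is the theorem of Pythagoras.
  have h1 : hsSq (Wᴴ * S) ≤ hsSq S := by
    have key : Sᴴ * S = (Wᴴ * S)ᴴ * (Wᴴ * S) + (S - W * Wᴴ * S)ᴴ * (S - W * Wᴴ * S) := by
      have e1 : W * Wᴴ * (W * Wᴴ) = W * Wᴴ := by
        rw [← Matrix.mul_assoc, Matrix.mul_assoc W, hWd]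
      have e2 : Sᴴ * (W * Wᴴ * (W * Wᴴ)) * S = Sᴴ * (W * Wᴴ) * S := by rw [e1]
      simp only [conjTranspose_sub, conjTranspose_mul, conjTranspose_conjTranspose, Matrix.sub_mul,
        Matrix.mul_sub, Matrix.mul_assoc] at e2 ⊢
      rw [e2]; abel
    have := congrArg Matrix.trace key
    rw [trace_add, trace_conjTranspose_mul_self_eq, trace_conjTranspose_mul_self_eq,
      trace_conjTranspose_mul_self_eq] at this
    have h : hsSq S = hsSq (Wᴴ * S) + hsSq (S - W * Wᴴ * S) := by exact_mod_cast this
    linarith [hsSq_nonneg (S - W * Wᴴ * S)]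
  have h2 : hsSq (Y * V) = hsSq Y := by
    have : ((hsSq (Y * V) : ℝ) : ℂ) = (hsSq Y : ℝ) := by
      rw [← trace_conjTranspose_mul_self_eq, ← trace_conjTranspose_mul_self_eq, conjTranspose_mul,
        Matrix.mul_assoc, trace_mul_comm, Matrix.mul_assoc, Matrix.mul_assoc, hVV', Matrix.mul_one]
    exact_mod_cast this
  have h3 := norm_trace_mul_sq_le (Wᴴ * S) (Y * V)
  have h4 : Wᴴ * S * (Y * V) = Wᴴ * X * V := by simp only [hX, Matrix.mul_assoc]
  rw [h4, hWX, Complex.norm_real, Real.norm_eq_abs, sq_abs, h2] at h3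
  exact h3.trans (mul_le_mul_of_nonneg_right h1 (hsSq_nonneg Y))

/-! ### Mutually unbiased bases -/

/-- Bessel's inequality for the traceless parts of the projectors onto the rows of the `V θ`:
for different `θ` these traceless parts are Hilbert–Schmidt orthogonal. -/
theorem sum_norm_diag_sq_le_hsSq {N Θ : Type*} [Fintype N] [DecidableEq N] [Fintype Θ]
    (V : Θ → Matrix N N ℂ) (hV : ∀ θ, V θ * (V θ)ᴴ = 1) (c : ℝ)
    (hc : ∀ θ θ', θ ≠ θ' → ∀ x x', ‖(V θ * (V θ')ᴴ) x x'‖ ^ 2 = c)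
    (B : Matrix N N ℂ) (hB : B.trace = 0) :
    ∑ θ, ∑ x, ‖(V θ * B * (V θ)ᴴ) x x‖ ^ 2 ≤ hsSq B := by
  classical
  set q : Θ → N → ℂ := fun θ x => (V θ * B * (V θ)ᴴ) x x with hq
  have hq0 : ∀ θ, ∑ x, q θ x = 0 := by
    intro θ
    have : ∑ x, q θ x = (V θ * B * (V θ)ᴴ).trace := rfl
    rw [this, trace_mul_cycle, mul_eq_one_comm.1 (hV θ), Matrix.one_mul, hB]
  -- `G` is the orthogonal projection of `B` to the span of the projectors.
  set G : Matrix N N ℂ := ∑ θ, (V θ)ᴴ * diagonal (q θ) * V θ with hG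
  have hGH : Gᴴ = ∑ θ, (V θ)ᴴ * diagonal (star (q θ)) * V θ := by
    simp [hG, conjTranspose_sum, Matrix.mul_assoc]
  have hGB : (Gᴴ * B).trace = ((∑ θ, ∑ x, ‖q θ x‖ ^ 2 : ℝ) : ℂ) := by
    rw [hGH, Matrix.sum_mul, trace_sum]
    push_cast
    refine Finset.sum_congr rfl fun θ _ => ?_
    have : ((V θ)ᴴ * diagonal (star (q θ)) * V θ * B).trace =
        (diagonal (star (q θ)) * (V θ * B * (V θ)ᴴ)).trace := by
      rw [Matrix.mul_assoc, Matrix.mul_assoc, trace_mul_comm]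
      simp only [Matrix.mul_assoc]
    rw [this]
    simp only [Matrix.trace, Matrix.diag, diagonal_mul]
    refine Finset.sum_congr rfl fun x _ => ?_
    rw [← Complex.conj_mul']; rfl
  -- The terms with `θ ≠ θ'` vanish: all overlaps agree and each `q θ` sums to zero.
  have hGG : (Gᴴ * G).trace = ((∑ θ, ∑ x, ‖q θ x‖ ^ 2 : ℝ) : ℂ) := by
    have h1 : ∀ θ θ', ((V θ)ᴴ * diagonal (star (q θ)) * V θ *
        ((V θ')ᴴ * diagonal (q θ') * V θ')).trace =
        ∑ x, ∑ x', star (q θ x) * q θ' x' * (‖(V θ * (V θ')ᴴ) x x'‖ ^ 2 : ℝ) := by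
      intro θ θ'
      set W := V θ * (V θ')ᴴ with hW
      have : ((V θ)ᴴ * diagonal (star (q θ)) * V θ *
        ((V θ')ᴴ * diagonal (q θ') * V θ')).trace =
          ((diagonal (star (q θ)) * W) * (diagonal (q θ') * Wᴴ)).trace := by
        simp only [hW, conjTranspose_mul, conjTranspose_conjTranspose, Matrix.mul_assoc]
        rw [trace_mul_comm]
        simp only [Matrix.mul_assoc]
      rw [this]
      simp only [Matrix.trace, Matrix.diag, Matrix.mul_apply (M := diagonal (star (q θ)) * W),
        diagonal_mul, conjTranspose_apply]
      refine Finset.sum_congr rfl fun x _ => Finset.sum_congr rfl fun x' _ => ?_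
      push_cast
      rw [← Complex.conj_mul']
      simp only [Pi.star_apply, RCLike.star_def]
      ring
    rw [hGH, hG, Matrix.sum_mul, trace_sum]
    push_cast
    refine Finset.sum_congr rfl fun θ _ => ?_
    rw [Matrix.mul_sum, trace_sum, Finset.sum_eq_single θ]
    · rw [h1, hV]
      refine Finset.sum_congr rfl fun x _ => ?_
      rw [Finset.sum_eq_single x]
      · rw [← Complex.conj_mul']; simp
      · intro y _ hy; simp [Matrix.one_apply_ne hy.symm]
      · simp
    · intro θ' _ hne
      rw [h1]
      simp only [hc θ θ' hne.symm]
      have : ∀ x, ∑ x', star (q θ x) * q θ' x' * (c : ℂ) = 0 := by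
        intro x
        rw [← Finset.sum_mul, ← Finset.mul_sum, hq0]; simp
      simp only [this, Finset.sum_const_zero]
    · simp
  have hBG : (Bᴴ * G).trace = ((∑ θ, ∑ x, ‖q θ x‖ ^ 2 : ℝ) : ℂ) := by
    have := congrArg star hGB
    rw [← trace_conjTranspose, conjTranspose_mul, conjTranspose_conjTranspose] at this
    rw [this]; exact Complex.conj_ofReal _
  have h := trace_conjTranspose_mul_self_eq (B - G)
  rw [conjTranspose_sub, Matrix.sub_mul, Matrix.mul_sub, Matrix.mul_sub, trace_sub, trace_sub,
    trace_sub, hGG, hGB, hBG, trace_conjTranspose_mul_self_eq] at h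
  have h' : hsSq B - ∑ θ, ∑ x, ‖q θ x‖ ^ 2 = hsSq (B - G) := by
    rw [sub_self, sub_zero] at h
    exact_mod_cast h
  linarith [hsSq_nonneg (B - G)]

/-! ### Pairwise independent permutations -/

/-- For a pairwise independent family, the number of indices `j` for which `P j` sends two
different points into the same fibre of `g` does not depend on the points. -/
theorem PairwiseIndependent.exists_collision_card {X J C : Type*} [Fintype X] [DecidableEq X]
    [Fintype J] [DecidableEq C] {P : J → Equiv.Perm X} (hP : PairwiseIndependent P) (g : X → C) :
    ∃ κ : ℝ, 0 ≤ κ ∧ ∀ x₁ x₂, x₁ ≠ x₂ →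
      ((Finset.univ.filter fun j => g (P j x₁) = g (P j x₂)).card : ℝ) = κ := by
  classical
  set T := Finset.univ.filter fun y : X × X => y.1 ≠ y.2 ∧ g y.1 = g y.2 with hT
  have key : ∀ x₁ x₂, x₁ ≠ x₂ →
      ((Finset.univ.filter fun j => g (P j x₁) = g (P j x₂)).card : ℝ) =
      ∑ y ∈ T, (Fintype.card J : ℝ) *
        (1 / ((Fintype.card X : ℝ) * ((Fintype.card X : ℝ) - 1))) := by
    intro x₁ x₂ hx
    rw [Finset.card_eq_sum_card_fiberwise (f := fun j => (P j x₁, P j x₂)) (t := T)]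
    · push_cast
      refine Finset.sum_congr rfl fun y hy => ?_
      rw [hT, Finset.mem_filter] at hy
      rw [← hP x₁ x₂ y.1 y.2 hx hy.2.1, Finset.filter_filter]
      have : (Finset.univ.filter fun j => g (P j x₁) = g (P j x₂) ∧ (P j x₁, P j x₂) = y) =
          Finset.univ.filter fun j => P j x₁ = y.1 ∧ P j x₂ = y.2 := by
        ext j
        simp only [Finset.mem_filter, Finset.mem_univ, true_and, Prod.ext_iff]
        constructor
        · exact fun h => h.2
        · rintro ⟨h1, h2⟩
          exact ⟨by rw [h1, h2]; exact hy.2.2, h1, h2⟩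
      rw [this]
      rcases Nat.eq_zero_or_pos (Fintype.card J) with h0 | h0
      · have := Fintype.card_eq_zero_iff.1 h0
        simp
      · have : (Fintype.card J : ℝ) ≠ 0 := by positivity
        field_simp
    · intro j hj
      simp only [Finset.coe_filter, Finset.mem_univ, true_and, Set.mem_ofPred_eq] at hj
      simp [hT, hj, hx]
  by_cases hX : ∃ x₁ x₂ : X, x₁ ≠ x₂
  · obtain ⟨x₁, x₂, hx⟩ := hX
    exact ⟨_, (key x₁ x₂ hx) ▸ Nat.cast_nonneg _, key⟩
  · push Not at hX
    exact ⟨0, le_rfl, fun x₁ x₂ h => (h (hX x₁ x₂)).elim⟩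

/-- Summing a mean-zero function over the fibres of a randomly permuted partition does not
increase its second moment: distinct points collide with equal probability, and their
correlations add up to a non-positive number. -/
theorem PairwiseIndependent.sum_norm_fiber_sq_le {N J M M' : Type*} [Fintype N] [DecidableEq N]
    [Fintype J] [Fintype M] [DecidableEq M] [Fintype M'] {P : J → Equiv.Perm N}
    (hP : PairwiseIndependent P) (e : N ≃ M × M') (f : N → ℂ) (hf : ∑ x, f x = 0) :
    ∑ j, ∑ m, ‖∑ m', f ((P j).symm (e.symm (m, m')))‖ ^ 2 ≤
      Fintype.card J * ∑ x, ‖f x‖ ^ 2 := by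
  obtain ⟨κ, hκ, hκ'⟩ := hP.exists_collision_card (fun x => (e x).1)
  have h1 : ∀ j m, ∑ m', f ((P j).symm (e.symm (m, m'))) =
      ∑ x, if (e (P j x)).1 = m then f x else 0 := by
    intro j m
    rw [← ((P j).trans e).symm.sum_comp, Fintype.sum_prod_type, Finset.sum_eq_single m]
    · simp
    · intro m₁ _ hne; simp [hne]
    · simp
  have h2 : ∀ j m, ((‖∑ m', f ((P j).symm (e.symm (m, m')))‖ ^ 2 : ℝ) : ℂ) =
      ∑ x, ∑ y, if (e (P j x)).1 = m ∧ (e (P j y)).1 = m then star (f x) * f y else 0 := by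
    intro j m
    push_cast
    rw [← Complex.conj_mul', h1, map_sum, Finset.sum_mul_sum]
    refine Finset.sum_congr rfl fun x _ => Finset.sum_congr rfl fun y _ => ?_
    by_cases hx : (e (P j x)).1 = m <;> by_cases hy : (e (P j y)).1 = m <;> simp [hx, hy]
  have h3 : ((∑ j, ∑ m, ‖∑ m', f ((P j).symm (e.symm (m, m')))‖ ^ 2 : ℝ) : ℂ) =
      ∑ x, ∑ y, ((Finset.univ.filter fun j => (e (P j x)).1 = (e (P j y)).1).card : ℂ) *
        (star (f x) * f y) := by
    have h4 : ∀ j, ∑ m, ((‖∑ m', f ((P j).symm (e.symm (m, m')))‖ ^ 2 : ℝ) : ℂ) =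
        ∑ x, ∑ y, if (e (P j x)).1 = (e (P j y)).1 then star (f x) * f y else 0 := by
      intro j
      simp only [h2]
      rw [Finset.sum_comm]
      refine Finset.sum_congr rfl fun x _ => ?_
      rw [Finset.sum_comm]
      refine Finset.sum_congr rfl fun y _ => ?_
      rw [Finset.sum_eq_single (e (P j x)).1]
      · simp [eq_comm]
      · intro m _ hne; simp [hne.symm]
      · simp
    rw [Complex.ofReal_sum]
    simp only [Complex.ofReal_sum, h4]
    rw [Finset.sum_comm]
    refine Finset.sum_congr rfl fun x _ => ?_
    rw [Finset.sum_comm]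
    refine Finset.sum_congr rfl fun y _ => ?_
    rw [← Finset.sum_filter, Finset.sum_const, nsmul_eq_mul]
  -- The `κ`-part sums to `κ |∑ f|² = 0`, and only the excess `|J| - κ` on the diagonal is left.
  have h5 : ∀ x y, ((Finset.univ.filter fun j => (e (P j x)).1 = (e (P j y)).1).card : ℂ) *
        (star (f x) * f y) = κ * (star (f x) * f y) +
          if x = y then (((Fintype.card J - κ) * ‖f x‖ ^ 2 : ℝ) : ℂ) else 0 := by
    intro x y
    by_cases hxy : x = y
    · subst hxy
      push_cast
      rw [← Complex.conj_mul']
      simp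
      ring
    · have : ((Finset.univ.filter fun j => (e (P j x)).1 = (e (P j y)).1).card : ℂ) = (κ : ℂ) := by
        rw [← hκ' x y hxy]; norm_cast
      rw [this]; simp [hxy]
  simp only [h5, Finset.sum_add_distrib, ← Finset.mul_sum, hf, mul_zero,
    zero_add, Finset.sum_ite_eq, Finset.mem_univ, if_true] at h3
  have h6 : ∑ j, ∑ m, ‖∑ m', f ((P j).symm (e.symm (m, m')))‖ ^ 2 =
      ∑ x, (Fintype.card J - κ) * ‖f x‖ ^ 2 := by exact_mod_cast h3
  rw [h6, ← Finset.mul_sum]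
  have : 0 ≤ ∑ x, ‖f x‖ ^ 2 := by positivity
  nlinarith

/-! ### The measurement statistics of a single matrix -/

/-- Permuting after a change of basis only relabels the measurement outcomes. -/
theorem permMatrix_mul_conj_diag {N : Type*} [Fintype N] [DecidableEq N] (π : Equiv.Perm N)
    (V A : Matrix N N ℂ) (y : N) :
    ((permMatrix π * V) * A * (permMatrix π * V)ᴴ) y y =
      (V * A * Vᴴ) (π.symm y) (π.symm y) := by
  have h : permMatrix π * V = V.submatrix π.symm id := by
    ext i j
    rw [Matrix.mul_apply, Finset.sum_eq_single (π.symm i)]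
    · simp [permMatrix]
    · intro x _ hx
      have : i ≠ π x := fun h => hx (by simp [h])
      simp [permMatrix, this]
    · simp
  rw [h]; rfl

/-- Subtracting the multiple of the identity that makes a matrix traceless is an orthogonal
projection for the Hilbert–Schmidt inner product. -/
theorem hsSq_sub_smul_one_le {N : Type*} [Fintype N] [DecidableEq N]
    (A : Matrix N N ℂ) (s : ℂ) (h : (A - s • (1 : Matrix N N ℂ)).trace = 0) :
    hsSq (A - s • (1 : Matrix N N ℂ)) ≤ hsSq A := by
  set B := A - s • (1 : Matrix N N ℂ) with hB
  have hA : A = B + s • 1 := by simp [hB]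
  have hBt : Bᴴ.trace = 0 := by rw [trace_conjTranspose, h, star_zero]
  have h1 : (hsSq A : ℂ) = hsSq B + hsSq (s • (1 : Matrix N N ℂ)) := by
    simp only [← trace_conjTranspose_mul_self_eq]
    rw [hA, conjTranspose_add, Matrix.add_mul, Matrix.mul_add, Matrix.mul_add, trace_add,
      trace_add, trace_add]
    simp [h, hBt]
  have h2 : hsSq A = hsSq B + hsSq (s • (1 : Matrix N N ℂ)) := by exact_mod_cast h1
  linarith [hsSq_nonneg (s • (1 : Matrix N N ℂ))]

/-- Measuring in a random mutually unbiased basis, permuting at random and keeping the label `m`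
yields outcome weights whose total squared deviation from uniform is controlled by the
Hilbert–Schmidt norm. -/
theorem sum_norm_sub_uniform_sq_le {N J M M' Θ : Type*} [Fintype N] [DecidableEq N] [Nonempty N]
    [Fintype J] [Fintype M] [DecidableEq M] [Fintype M'] [Fintype Θ] {P : J → Equiv.Perm N}
    (hP : PairwiseIndependent P) (e : N ≃ M × M')
    (V : Θ → Matrix N N ℂ) (hV : ∀ θ, V θ * (V θ)ᴴ = 1) (c : ℝ)
    (hc : ∀ θ θ', θ ≠ θ' → ∀ x x', ‖(V θ * (V θ')ᴴ) x x'‖ ^ 2 = c) (A : Matrix N N ℂ) :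
    ∑ i : J × Θ, ∑ m, ‖∑ m', ((permMatrix (P i.1) * V i.2) * A *
        (permMatrix (P i.1) * V i.2)ᴴ) (e.symm (m, m')) (e.symm (m, m')) -
        (Fintype.card M : ℂ)⁻¹ * A.trace‖ ^ 2 ≤ Fintype.card J * hsSq A := by
  have hN : (Fintype.card N : ℂ) ≠ 0 := by simp [Fintype.card_ne_zero]
  have hcard : (Fintype.card N : ℂ) = Fintype.card M * Fintype.card M' := by
    rw [Fintype.card_congr e, Fintype.card_prod]; push_cast; rfl
  set s : ℂ := (Fintype.card N : ℂ)⁻¹ * A.trace with hs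
  set B := A - s • (1 : Matrix N N ℂ) with hB
  have hBt : B.trace = 0 := by
    rw [hB, trace_sub, trace_smul, trace_one, smul_eq_mul, hs]
    field_simp
    simp
  -- Removing the trace of `A` amounts to subtracting the mean of the outcome weights.
  have hdiag : ∀ θ x, (V θ * A * (V θ)ᴴ) x x = (V θ * B * (V θ)ᴴ) x x + s := by
    intro θ x
    rw [hB, Matrix.mul_sub, Matrix.sub_mul, Matrix.mul_smul, Matrix.smul_mul, Matrix.mul_one, hV]
    simp
  have hterm : ∀ (i : J × Θ) (m : M),
      ∑ m', ((permMatrix (P i.1) * V i.2) * A *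
        (permMatrix (P i.1) * V i.2)ᴴ) (e.symm (m, m')) (e.symm (m, m')) -
        (Fintype.card M : ℂ)⁻¹ * A.trace =
      ∑ m', (fun x => (V i.2 * B * (V i.2)ᴴ) x x) ((P i.1).symm (e.symm (m, m'))) := by
    intro i m
    simp only [permMatrix_mul_conj_diag, hdiag, Finset.sum_add_distrib, Finset.sum_const,
      nsmul_eq_mul, Finset.card_univ]
    have : (Fintype.card M' : ℂ) * s = (Fintype.card M : ℂ)⁻¹ * A.trace := by
      rw [hs, hcard]
      rw [hcard] at hN
      have h1 := left_ne_zero_of_mul hN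
      have h2 := right_ne_zero_of_mul hN
      field_simp
    rw [this]; ring
  simp only [hterm]
  rw [Fintype.sum_prod_type, Finset.sum_comm]
  calc _ ≤ ∑ θ, Fintype.card J * ∑ x, ‖(V θ * B * (V θ)ᴴ) x x‖ ^ 2 := by
        refine Finset.sum_le_sum fun θ _ => ?_
        refine hP.sum_norm_fiber_sq_le e (fun x => (V θ * B * (V θ)ᴴ) x x) ?_
        have : ∑ x, (V θ * B * (V θ)ᴴ) x x = (V θ * B * (V θ)ᴴ).trace := rfl
        rw [this, trace_mul_cycle, mul_eq_one_comm.1 (hV θ), Matrix.one_mul, hBt]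
    _ ≤ Fintype.card J * hsSq A := by
        rw [← Finset.mul_sum]
        refine mul_le_mul_of_nonneg_left ?_ (Nat.cast_nonneg _)
        exact (sum_norm_diag_sq_le_hsSq V hV c hc B hBt).trans (hsSq_sub_smul_one_le A s hBt)

/-- The rows of `U θ` are the conjugated basis vectors of `b θ`, so the overlaps of the bases are the
entries of `U θ (U θ')†`. -/
theorem MutuallyUnbiased.norm_mul_conjTranspose_sq {N Θ : Type*} [Fintype N] [DecidableEq N]
    {b : Θ → OrthonormalBasis N ℂ (EuclideanSpace ℂ N)} (hb : MutuallyUnbiased b)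
    (U : Θ → Matrix.unitaryGroup N ℂ)
    (hU : ∀ θ n, Matrix.toEuclideanLin (U θ : Matrix N N ℂ) (b θ n) =
      EuclideanSpace.single n (1 : ℂ)) (θ θ' : Θ) (h : θ ≠ θ') (x x' : N) :
    ‖((U θ : Matrix N N ℂ) * (U θ' : Matrix N N ℂ)ᴴ) x x'‖ ^ 2 = 1 / (Fintype.card N : ℝ) := by
  have hrow : ∀ θ x n, (b θ x) n = star ((U θ : Matrix N N ℂ) x n) := by
    intro θ x n
    have h1 : (U θ : Matrix N N ℂ) *ᵥ (b θ x).ofLp = Pi.single x 1 := by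
      have := congrArg WithLp.ofLp (hU θ x)
      rwa [Matrix.ofLp_toLpLin, Matrix.toLin'_apply] at this
    have h2 := congrArg (fun v => ((U θ : Matrix N N ℂ)ᴴ *ᵥ v) n) h1
    simp only [Matrix.mulVec_mulVec] at h2
    rw [show (U θ : Matrix N N ℂ)ᴴ * (U θ : Matrix N N ℂ) = 1 from
      Matrix.mem_unitaryGroup_iff'.1 (U θ).2] at h2
    simpa using h2
  have h1 : inner ℂ (b θ x) (b θ' x') =
      ((U θ : Matrix N N ℂ) * (U θ' : Matrix N N ℂ)ᴴ) x x' := by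
    simp [PiLp.inner_apply, hrow, Matrix.mul_apply, mul_comm]
  rw [← h1, hb θ θ' h, div_pow, Real.sq_sqrt (Nat.cast_nonneg _), one_pow]

/-! ### The extractor output, block by block -/

theorem one_kronecker_mul_apply {N R : Type*} [Fintype N] [DecidableEq N] [Fintype R]
    (S : Matrix R R ℂ) (Y : Matrix (N × R) (N × R) ℂ)
    (a b : N × R) :
    (((1 : Matrix N N ℂ) ⊗ₖ S) * Y) a b = ∑ r, S a.2 r * Y (a.1, r) b := by
  rw [Matrix.mul_apply, Fintype.sum_prod_type, Finset.sum_eq_single a.1]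
  · simp
  · intro x _ hx; simp [Matrix.one_apply_ne hx.symm]
  · simp

/-- The operator `⟨r| Y |s⟩` on `N`, for basis vectors `r`, `s` of `R`. -/
def block {N R : Type*} (Y : Matrix (N × R) (N × R) ℂ) (r s : R) : Matrix N N ℂ :=
  Matrix.of fun n n' => Y (n, r) (n', s)

theorem hsSq_eq_sum_block {N R : Type*} [Fintype N] [Fintype R] (Y : Matrix (N × R) (N × R) ℂ) :
    hsSq Y = ∑ r, ∑ s, hsSq (block Y r s) := by
  simp only [hsSq, block, Matrix.of_apply, Fintype.sum_prod_type_right]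
  exact Finset.sum_congr rfl fun r _ => Finset.sum_comm

section Output

variable {N M M' R D : Type*} [Fintype N] [DecidableEq N] [Fintype M] [DecidableEq M]
  [Fintype M'] [Fintype R] [Fintype D] [DecidableEq D]

theorem measure_one_kronecker_mul (e : N ≃ M × M') (S : Matrix R R ℂ)
    (Y : Matrix (N × R) (N × R) ℂ) :
    measure e (((1 : Matrix N N ℂ) ⊗ₖ S) * Y) = ((1 : Matrix M M ℂ) ⊗ₖ S) * measure e Y := by
  ext a b
  rw [one_kronecker_mul_apply]
  simp only [measure, Matrix.of_apply, one_kronecker_mul_apply]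
  split_ifs
  · rw [Finset.sum_comm]; simp only [Finset.mul_sum]
  · simp

theorem conjugate_one_kronecker_mul [DecidableEq R] (U : Matrix N N ℂ) (S : Matrix R R ℂ)
    (Y : Matrix (N × R) (N × R) ℂ) :
    conjugate U (((1 : Matrix N N ℂ) ⊗ₖ S) * Y) = ((1 : Matrix N N ℂ) ⊗ₖ S) * conjugate U Y := by
  have : (U ⊗ₖ (1 : Matrix R R ℂ)) * ((1 : Matrix N N ℂ) ⊗ₖ S) =
      ((1 : Matrix N N ℂ) ⊗ₖ S) * (U ⊗ₖ (1 : Matrix R R ℂ)) := by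
    rw [← mul_kronecker_mul, ← mul_kronecker_mul]; simp
  simp only [conjugate, ← Matrix.mul_assoc, this]

theorem marginalRight_one_kronecker_mul (S : Matrix R R ℂ) (Y : Matrix (N × R) (N × R) ℂ) :
    marginalRight (((1 : Matrix N N ℂ) ⊗ₖ S) * Y) = S * marginalRight Y := by
  ext r s
  rw [Matrix.mul_apply]
  simp only [marginalRight, Matrix.of_apply, one_kronecker_mul_apply, Finset.mul_sum]
  rw [Finset.sum_comm]

/-- Acting on the side information from the left commutes with the extractor. -/
theorem realOutput_sub_idealOutput_one_kronecker_mul [DecidableEq R] (e : N ≃ M × M')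
    (U : D → Matrix.unitaryGroup N ℂ) (S : Matrix R R ℂ) (Y : Matrix (N × R) (N × R) ℂ) :
    realOutput e U (((1 : Matrix N N ℂ) ⊗ₖ S) * Y) -
        idealOutput M D (((1 : Matrix N N ℂ) ⊗ₖ S) * Y) =
      (((1 : Matrix M M ℂ) ⊗ₖ S) ⊗ₖ (1 : Matrix D D ℂ)) *
        (realOutput e U Y - idealOutput M D Y) := by
  rw [Matrix.mul_sub]
  congr 1
  · simp only [realOutput, conjugate_one_kronecker_mul, measure_one_kronecker_mul,
      Matrix.mul_smul, Matrix.mul_sum, ← mul_kronecker_mul, Matrix.one_mul]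
  · simp only [idealOutput, marginalRight_one_kronecker_mul, ← mul_kronecker_mul, Matrix.one_mul]

theorem conjugate_apply [DecidableEq R] (U : Matrix N N ℂ) (Y : Matrix (N × R) (N × R) ℂ)
    (x x' : N) (r s : R) :
    conjugate U Y (x, r) (x', s) = (U * block Y r s * Uᴴ) x x' := by
  simp only [conjugate, conjTranspose_kronecker, Matrix.mul_apply, Fintype.sum_prod_type, block,
    Matrix.of_apply, kroneckerMap_apply, conjTranspose_one, Matrix.one_apply]
  simp

theorem realOutput_sub_idealOutput_apply [DecidableEq R] (e : N ≃ M × M')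
    (U : D → Matrix.unitaryGroup N ℂ) (Y : Matrix (N × R) (N × R) ℂ) (m m₁ : M) (r s : R)
    (i j : D) :
    (realOutput e U Y - idealOutput M D Y) ((m, r), i) ((m₁, s), j) =
      if m = m₁ ∧ i = j then (Fintype.card D : ℂ)⁻¹ *
        (∑ m' : M', ((U i : Matrix N N ℂ) * block Y r s * (U i : Matrix N N ℂ)ᴴ)
          (e.symm (m, m')) (e.symm (m, m')) - (Fintype.card M : ℂ)⁻¹ * (block Y r s).trace)
      else 0 := by
  have htr : marginalRight Y r s = (block Y r s).trace := rfl
  have hreal : realOutput e U Y ((m, r), i) ((m₁, s), j) =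
      if m = m₁ ∧ i = j then (Fintype.card D : ℂ)⁻¹ *
        ∑ m' : M', ((U i : Matrix N N ℂ) * block Y r s * (U i : Matrix N N ℂ)ᴴ)
          (e.symm (m, m')) (e.symm (m, m')) else 0 := by
    simp only [realOutput, Matrix.smul_apply, Matrix.sum_apply, kroneckerMap_apply, smul_eq_mul]
    rw [Finset.sum_eq_single i]
    · by_cases h1 : m = m₁ <;> by_cases h2 : i = j <;>
        simp [h1, h2, measure, conjugate_apply, Matrix.single]
    · intro k _ hk; simp [Matrix.single, hk]
    · simp
  rw [Matrix.sub_apply, hreal]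
  by_cases h1 : m = m₁ <;> by_cases h2 : i = j <;>
    simp [h1, h2, idealOutput, htr]
  ring

theorem hsSq_realOutput_sub_idealOutput [DecidableEq R] (e : N ≃ M × M')
    (U : D → Matrix.unitaryGroup N ℂ) (Y : Matrix (N × R) (N × R) ℂ) :
    hsSq (realOutput e U Y - idealOutput M D Y) =
      ((Fintype.card D : ℝ)⁻¹) ^ 2 * ∑ r, ∑ s, ∑ i, ∑ m,
        ‖∑ m' : M', ((U i : Matrix N N ℂ) * block Y r s * (U i : Matrix N N ℂ)ᴴ)
          (e.symm (m, m')) (e.symm (m, m')) -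
          (Fintype.card M : ℂ)⁻¹ * (block Y r s).trace‖ ^ 2 := by
  have h : ∀ (m : M) (r : R) (i : D), ∑ b : (M × R) × D,
      ‖(realOutput e U Y - idealOutput M D Y) ((m, r), i) b‖ ^ 2 =
      ∑ s, ((Fintype.card D : ℝ)⁻¹) ^ 2 *
        ‖∑ m' : M', ((U i : Matrix N N ℂ) * block Y r s * (U i : Matrix N N ℂ)ᴴ)
          (e.symm (m, m')) (e.symm (m, m')) -
          (Fintype.card M : ℂ)⁻¹ * (block Y r s).trace‖ ^ 2 := by
    intro m r i
    rw [Fintype.sum_prod_type, Fintype.sum_prod_type, Finset.sum_eq_single m]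
    · refine Finset.sum_congr rfl fun s _ => ?_
      rw [Finset.sum_eq_single i]
      · rw [realOutput_sub_idealOutput_apply]
        simp [mul_pow]
      · intro j _ hj
        rw [realOutput_sub_idealOutput_apply, if_neg (fun h => hj h.2.symm)]; simp
      · simp
    · intro m₁ _ hm
      refine Finset.sum_eq_zero fun s _ => Finset.sum_eq_zero fun j _ => ?_
      rw [realOutput_sub_idealOutput_apply, if_neg (fun h => hm h.1.symm)]; simp
    · simp
  unfold hsSq
  rw [Fintype.sum_prod_type, Fintype.sum_prod_type]
  simp only [h, Finset.mul_sum]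
  rw [Finset.sum_comm]
  refine Finset.sum_congr rfl fun r _ => ?_
  rw [Finset.sum_comm]
  conv_rhs => rw [Finset.sum_comm]
  refine Finset.sum_congr rfl fun i _ => ?_
  rw [Finset.sum_comm]

end Output

theorem hsSq_one_kronecker_kronecker_one {M R D : Type*} [Fintype M] [DecidableEq M] [Fintype R]
    [Fintype D] [DecidableEq D] (S : Matrix R R ℂ) :
    hsSq (((1 : Matrix M M ℂ) ⊗ₖ S) ⊗ₖ (1 : Matrix D D ℂ)) =
      Fintype.card M * Fintype.card D * hsSq S := by
  have : (hsSq (((1 : Matrix M M ℂ) ⊗ₖ S) ⊗ₖ (1 : Matrix D D ℂ)) : ℂ) =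
      Fintype.card M * Fintype.card D * hsSq S := by
    rw [← trace_conjTranspose_mul_self_eq, ← trace_conjTranspose_mul_self_eq]
    simp only [conjTranspose_kronecker, ← mul_kronecker_mul, trace_kronecker, conjTranspose_one,
      Matrix.one_mul, trace_one]
    ring
  exact_mod_cast this

/-! ### Operators dominating the state -/

/-- If `0 ≤ ρ ≤ ω` with `ω` positive definite, then `ρ ω⁻¹ ρ ≤ ρ`. Both sides are compared through
the Schur complement of the positive block matrix with rows `(ω, ρ)` and `(ρ, ρ)`. -/
theorem posSemidef_sub_mul_inv_mul {n : Type*} [Fintype n] [DecidableEq n] {ρ ω : Matrix n n ℂ}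
    (hρ : ρ.PosSemidef) (hω : ω.PosDef) (h : (ω - ρ).PosSemidef) :
    (ρ - ρ * ω⁻¹ * ρ).PosSemidef := by
  have := hω.isUnit.invertible
  have hb : (fromBlocks ω ρ ρᴴ ρ).PosSemidef := by
    have h1 := (h.mul_mul_conjTranspose_same (fromRows (1 : Matrix n n ℂ) (0 : Matrix n n ℂ))).add
      (hρ.mul_mul_conjTranspose_same (fromRows (1 : Matrix n n ℂ) (1 : Matrix n n ℂ)))
    convert h1 using 1
    rw [hρ.1.eq, conjTranspose_fromRows_eq_fromCols_conjTranspose,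
      conjTranspose_fromRows_eq_fromCols_conjTranspose, fromRows_mul (A₁ := 1) (A₂ := 0) (B := ω - ρ),
      fromRows_mul (A₁ := 1) (A₂ := 1) (B := ρ),
      fromRows_mul_fromCols, fromRows_mul_fromCols, fromBlocks_add]
    simp
  rw [hω.fromBlocks₁₁, hρ.1.eq] at hb
  exact hb

/-- The left-hand side is `tr (ρ (1 ⊗ S S†)⁻¹ ρ)`, which is at most `tr ρ`. -/
theorem hsSq_inv_mul_le {N R : Type*} [Fintype N] [DecidableEq N] [Fintype R] [DecidableEq R]
    {ρ : Matrix (N × R) (N × R) ℂ} (hρ : ρ ∈ States (N × R)) {S : Matrix R R ℂ}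
    (hω : (S * Sᴴ).PosDef)
    (h : ((1 : Matrix N N ℂ) ⊗ₖ (S * Sᴴ) - ρ).PosSemidef) :
    hsSq (((1 : Matrix N N ℂ) ⊗ₖ S⁻¹) * ρ) ≤ 1 := by
  have h1 := (posSemidef_sub_mul_inv_mul hρ.1 (PosDef.one.kronecker hω) h).trace_nonneg
  have h2 : (((1 : Matrix N N ℂ) ⊗ₖ S⁻¹) * ρ)ᴴ * (((1 : Matrix N N ℂ) ⊗ₖ S⁻¹) * ρ) =
      ρ * ((1 : Matrix N N ℂ) ⊗ₖ (S * Sᴴ))⁻¹ * ρ := by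
    rw [inv_kronecker, Matrix.mul_inv_rev, conjTranspose_mul, hρ.1.1.eq, conjTranspose_kronecker,
      conjTranspose_nonsing_inv]
    have : (1 : Matrix N N ℂ)⁻¹ ⊗ₖ (Sᴴ⁻¹ * S⁻¹) =
        ((1 : Matrix N N ℂ)ᴴ ⊗ₖ Sᴴ⁻¹) * ((1 : Matrix N N ℂ) ⊗ₖ S⁻¹) := by
      rw [← mul_kronecker_mul]; simp
    rw [this]
    simp only [Matrix.mul_assoc]
  rw [trace_sub, ← h2, trace_conjTranspose_mul_self_eq, hρ.2, sub_nonneg] at h1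
  exact_mod_cast h1

open scoped MatrixOrder in
theorem exists_eq_mul_conjTranspose {n : Type*} [Fintype n] [DecidableEq n] {ω : Matrix n n ℂ}
    (hω : ω.PosSemidef) : ∃ S : Matrix n n ℂ, ω = S * Sᴴ := by
  obtain ⟨b, hb⟩ := CStarAlgebra.nonneg_iff_eq_star_mul_self.1 hω.nonneg
  exact ⟨bᴴ, by rw [conjTranspose_conjTranspose]; exact hb⟩

/-- A lower bound on the min-entropy yields a positive definite operator that dominates the state.
One factor `2` pays for choosing a near-optimal `σ`, the other for making `σ` invertible by adding
the maximally mixed state. -/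
theorem exists_dominating_of_le_Hmin {N R : Type*} [Fintype N] [DecidableEq N] [Fintype R]
    [DecidableEq R] {ρ : Matrix (N × R) (N × R) ℂ} {k : ℝ} (hk : (k : EReal) ≤ Hmin ρ) :
    ∃ S : Matrix R R ℂ, (S * Sᴴ).PosDef ∧ ((1 : Matrix N N ℂ) ⊗ₖ (S * Sᴴ) - ρ).PosSemidef ∧
      hsSq S ≤ 4 * (2 : ℝ) ^ (-k) := by
  -- The infimum over `σ` need not be known to be attained; the slack `1` in the exponent suffices.
  have h1 : (⨅ σ ∈ States R, Dmax ρ ((1 : Matrix N N ℂ) ⊗ₖ σ)) < ((-k + 1 : ℝ) : EReal) := by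
    refine lt_of_le_of_lt (EReal.le_neg_of_le_neg hk) ?_
    rw [← EReal.coe_neg, EReal.coe_lt_coe_iff]
    linarith
  simp only [iInf_lt_iff] at h1
  obtain ⟨σ, hσ, h2⟩ := h1
  obtain ⟨_, ⟨μ, hμ, rfl⟩, hμk⟩ := sInf_lt_iff.1 h2
  have hμk' : μ < -k + 1 := EReal.coe_lt_coe_iff.1 hμk
  have hμ' : ((((2 : ℝ) ^ μ : ℝ) : ℂ) • ((1 : Matrix N N ℂ) ⊗ₖ σ) - ρ).PosSemidef := hμ
  set t : ℝ := (2 : ℝ) ^ μ with ht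
  have ht0 : 0 < t := by positivity
  have htc : (0 : ℂ) < (t : ℂ) := by exact_mod_cast ht0
  have : Nonempty R := by
    by_contra hR
    rw [not_nonempty_iff] at hR
    have := hσ.2
    simp [Matrix.trace] at this
  set u : ℝ := (Fintype.card R : ℝ)⁻¹ with hu
  have hu0 : 0 < u := by positivity
  have huc : (0 : ℂ) < ((t * u : ℝ) : ℂ) := by exact_mod_cast mul_pos ht0 hu0
  have hI : (((t * u : ℝ) : ℂ) • (1 : Matrix R R ℂ)).PosDef := PosDef.one.smul huc
  have hσt : ((t : ℂ) • σ).PosSemidef := hσ.1.smul htc.le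
  obtain ⟨S, hS⟩ := exists_eq_mul_conjTranspose (hI.add_posSemidef hσt).posSemidef
  refine ⟨S, hS ▸ hI.add_posSemidef hσt, ?_, ?_⟩
  · have h3 := (PosSemidef.one.kronecker (x := (1 : Matrix N N ℂ)) hI.posSemidef).add hμ'
    rwa [← add_sub_assoc, ← kronecker_smul, ← kronecker_add, hS] at h3
  · have h3 : (hsSq S : ℂ) = ((2 * t : ℝ) : ℂ) := by
      rw [← trace_conjTranspose_mul_self_eq, trace_mul_comm, ← hS, trace_add, trace_smul,
        trace_smul, hσ.2, trace_one, hu]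
      have : (Fintype.card R : ℂ) ≠ 0 := by simp [Fintype.card_ne_zero]
      push_cast
      simp only [smul_eq_mul]
      field_simp
      norm_num
    have h4 : hsSq S = 2 * t := by exact_mod_cast h3
    have h5 : t ≤ 2 * (2 : ℝ) ^ (-k) := by
      calc t ≤ (2 : ℝ) ^ (-k + 1) := Real.rpow_le_rpow_of_exponent_le one_le_two hμk'.le
        _ = 2 * (2 : ℝ) ^ (-k) := by
          rw [Real.rpow_add two_pos, Real.rpow_one, mul_comm]
    linarith

/-! ### The extractor property -/

/-- The arithmetic of the parameters: the bound on the output size in exponential form. -/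
theorem card_mul_le_of_bits_le {N M : Type*} [Fintype N] [Nonempty N] [Fintype M] [Nonempty M]
    {k ε : ℝ} (hε : 0 < ε) (hm : bits M ≤ bits N + k - 2 * Real.logb 2 (1 / ε) - 2) :
    (Fintype.card M : ℝ) * (4 * (2 : ℝ) ^ (-k)) ≤ Fintype.card N * ε ^ 2 := by
  have hM : (0 : ℝ) < Fintype.card M := by exact_mod_cast Fintype.card_pos
  have hN : (0 : ℝ) < Fintype.card N := by exact_mod_cast Fintype.card_pos
  rw [← Real.logb_le_logb one_lt_two (by positivity) (by positivity),
    Real.logb_mul hM.ne' (by positivity), Real.logb_mul (by norm_num) (by positivity),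
    Real.logb_rpow two_pos (by norm_num), Real.logb_mul hN.ne' (by positivity), Real.logb_pow]
  have h4 : Real.logb 2 4 = 2 := by
    rw [show (4 : ℝ) = 2 ^ (2 : ℝ) by norm_num, Real.logb_rpow two_pos (by norm_num)]
  rw [one_div, Real.logb_inv] at hm
  unfold bits at hm
  rw [h4]
  push_cast
  linarith

theorem isStrongQCExtractor_of_pairwiseIndependent {N M M' J : Type*} [Fintype N] [DecidableEq N]
    [Fintype M] [DecidableEq M] [Fintype M'] [Fintype J] [DecidableEq J] [Nonempty J]
    (e : N ≃ M × M')
    (b : Fin (Fintype.card N + 1) → OrthonormalBasis N ℂ (EuclideanSpace ℂ N))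
    (hb : MutuallyUnbiased b)
    (U : Fin (Fintype.card N + 1) → Matrix.unitaryGroup N ℂ)
    (hU : ∀ θ n, Matrix.toEuclideanLin (U θ : Matrix N N ℂ) (b θ n) =
      EuclideanSpace.single n (1 : ℂ))
    {k ε : ℝ} (hε : 0 < ε) (hm : bits M ≤ bits N + k - 2 * Real.logb 2 (1 / ε) - 2)
    {P : J → Equiv.Perm N} (hP : PairwiseIndependent P) :
    IsStrongQCExtractor e k ε
      (fun i : J × Fin (Fintype.card N + 1) => permUnitary (P i.1) * U i.2) := by
  intro R _ _ ρ hρ hk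
  have : Nonempty N := by
    by_contra hN
    rw [not_nonempty_iff] at hN
    have := hρ.2
    simp [Matrix.trace] at this
  have : Nonempty M := ⟨(e (Classical.arbitrary N)).1⟩
  obtain ⟨S, hω, hdom, hS⟩ := exists_dominating_of_le_Hmin hk
  have hSu : IsUnit S.det := by
    have := (Matrix.isUnit_iff_isUnit_det _).1 hω.isUnit
    rw [det_mul] at this
    exact isUnit_of_mul_isUnit_left this
  set Y := ((1 : Matrix N N ℂ) ⊗ₖ S⁻¹) * ρ with hY
  have hY1 : hsSq Y ≤ 1 := hsSq_inv_mul_le hρ hω hdom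
  have hρY : ρ = ((1 : Matrix N N ℂ) ⊗ₖ S) * Y := by
    rw [hY, ← Matrix.mul_assoc, ← mul_kronecker_mul, Matrix.mul_nonsing_inv _ hSu]
    simp
  set W : J × Fin (Fintype.card N + 1) → Matrix.unitaryGroup N ℂ :=
    fun i => permUnitary (P i.1) * U i.2 with hW
  have hdev : ∀ r s, ∑ i, ∑ m,
        ‖∑ m' : M', ((W i : Matrix N N ℂ) * block Y r s * (W i : Matrix N N ℂ)ᴴ)
          (e.symm (m, m')) (e.symm (m, m')) -
          (Fintype.card M : ℂ)⁻¹ * (block Y r s).trace‖ ^ 2 ≤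
        Fintype.card J * hsSq (block Y r s) := fun r s =>
    sum_norm_sub_uniform_sq_le hP e (fun θ => (U θ : Matrix N N ℂ))
      (fun θ => Matrix.mem_unitaryGroup_iff.1 (U θ).2) _
      (hb.norm_mul_conjTranspose_sq U hU) (block Y r s)
  have hout : hsSq (realOutput e W Y - idealOutput M (J × Fin (Fintype.card N + 1)) Y) ≤
      ((Fintype.card (J × Fin (Fintype.card N + 1)) : ℝ)⁻¹) ^ 2 * (Fintype.card J * 1) := by
    rw [hsSq_realOutput_sub_idealOutput]
    refine mul_le_mul_of_nonneg_left ?_ (by positivity)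
    refine le_trans ?_ (mul_le_mul_of_nonneg_left hY1 (Nat.cast_nonneg _))
    rw [hsSq_eq_sum_block, Finset.mul_sum]
    refine Finset.sum_le_sum fun r _ => ?_
    rw [Finset.mul_sum]
    exact Finset.sum_le_sum fun s _ => hdev r s
  have hJ : (0 : ℝ) < Fintype.card J := by exact_mod_cast Fintype.card_pos
  have hM : (0 : ℝ) < Fintype.card M := by exact_mod_cast Fintype.card_pos
  have hN : (0 : ℝ) < Fintype.card N := by exact_mod_cast Fintype.card_pos
  have hsq := traceNorm_mul_sq_le
    (((1 : Matrix M M ℂ) ⊗ₖ S) ⊗ₖ (1 : Matrix (J × Fin (Fintype.card N + 1)) _ ℂ))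
    (realOutput e W Y - idealOutput M (J × Fin (Fintype.card N + 1)) Y)
  rw [← realOutput_sub_idealOutput_one_kronecker_mul, ← hρY, hsSq_one_kronecker_kronecker_one]
    at hsq
  refine le_of_sq_le_sq ?_ hε.le
  have hparam := card_mul_le_of_bits_le hε hm
  calc _ ≤ _ := hsq
    _ ≤ Fintype.card M * Fintype.card (J × Fin (Fintype.card N + 1)) * (4 * (2 : ℝ) ^ (-k)) *
        (((Fintype.card (J × Fin (Fintype.card N + 1)) : ℝ)⁻¹) ^ 2 * (Fintype.card J * 1)) :=
      mul_le_mul (mul_le_mul_of_nonneg_left hS (by positivity)) hout (hsSq_nonneg _)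
        (by positivity)
    _ = (Fintype.card M * (4 * (2 : ℝ) ^ (-k))) / (Fintype.card N + 1) := by
      rw [Fintype.card_prod, Fintype.card_fin]
      push_cast
      field_simp
    _ ≤ ε ^ 2 := by
      rw [div_le_iff₀ (by positivity)]
      nlinarith [sq_nonneg ε]

/-! ### Affine permutations -/

theorem pairwiseIndependent_affinePerm {F : Type*} [Field F] [Fintype F] [DecidableEq F] :
    PairwiseIndependent (affinePerm : Fˣ × F → Equiv.Perm F) := by
  intro x₁ x₂ y₁ y₂ hx hy
  have hx' : x₁ - x₂ ≠ 0 := sub_ne_zero.2 hx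
  have hy' : y₁ - y₂ ≠ 0 := sub_ne_zero.2 hy
  have h1 : (Finset.univ.filter fun j : Fˣ × F => affinePerm j x₁ = y₁ ∧ affinePerm j x₂ = y₂) =
      {(Units.mk0 ((y₁ - y₂) / (x₁ - x₂)) (div_ne_zero hy' hx'),
        y₁ - (y₁ - y₂) / (x₁ - x₂) * x₁)} := by
    ext ⟨a, c⟩
    simp only [Finset.mem_filter, Finset.mem_univ, true_and, Finset.mem_singleton, Prod.mk.injEq,
      Units.ext_iff, Units.val_mk0, affinePerm, Equiv.trans_apply, Units.mulLeft_apply,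
      Equiv.coe_addRight]
    constructor
    · rintro ⟨rfl, rfl⟩
      have : (a : F) = (a * x₁ + c - (a * x₂ + c)) / (x₁ - x₂) := by
        rw [eq_div_iff hx']; ring
      exact ⟨this, by rw [← this]; ring⟩
    · rintro ⟨ha, rfl⟩
      rw [ha]
      refine ⟨by ring, ?_⟩
      field_simp
      ring
  have hF : 1 ≤ Fintype.card F := Fintype.card_pos
  rw [h1, Finset.card_singleton, Fintype.card_prod, Fintype.card_units]
  push_cast [hF]
  rw [mul_comm]

theorem bits_affinePerm_seed_le {F : Type*} [Field F] [Fintype F] [DecidableEq F] :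
    bits ((Fˣ × F) × Fin (Fintype.card F + 1)) ≤ 3 * bits F := by
  have hF : 1 < Fintype.card F := Fintype.one_lt_card
  have hF' : (1 : ℝ) < Fintype.card F := by exact_mod_cast hF
  unfold bits
  rw [Fintype.card_prod, Fintype.card_prod, Fintype.card_fin, Fintype.card_units]
  push_cast [hF.le]
  have : (3 : ℝ) * Real.logb 2 (Fintype.card F) = Real.logb 2 ((Fintype.card F : ℝ) ^ 3) := by
    rw [Real.logb_pow]; norm_num
  rw [this]
  refine Real.logb_le_logb_of_le one_lt_two ?_ ?_
  · have : (0 : ℝ) < Fintype.card F - 1 := by linarith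
    positivity
  · nlinarith

end QCExtractor

theorem mainTheorem7 {N M M' : Type*} [Fintype N] [DecidableEq N] [Fintype M] [DecidableEq M]
    [Fintype M'] (e : N ≃ M × M')
    (b : Fin (Fintype.card N + 1) → OrthonormalBasis N ℂ (EuclideanSpace ℂ N))
    (hb : QCExtractor.MutuallyUnbiased b)
    (U : Fin (Fintype.card N + 1) → Matrix.unitaryGroup N ℂ)
    (hU : ∀ θ n, Matrix.toEuclideanLin (U θ : Matrix N N ℂ) (b θ n) =
      EuclideanSpace.single n (1 : ℂ))
    (k ε : ℝ) (hk : k ∈ Set.Icc (-QCExtractor.bits N) (QCExtractor.bits N)) (hε : 0 < ε)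
    (hm : QCExtractor.bits M ≤
      min (QCExtractor.bits N) (QCExtractor.bits N + k - 2 * Real.logb 2 (1 / ε) - 2)) :
    (∀ (J : Type*) [Fintype J] [DecidableEq J] [Nonempty J] (P : J → Equiv.Perm N),
      QCExtractor.PairwiseIndependent P →
        QCExtractor.IsStrongQCExtractor e k ε
          (fun i : J × Fin (Fintype.card N + 1) => QCExtractor.permUnitary (P i.1) * U i.2) ∧
        QCExtractor.bits (J × Fin (Fintype.card N + 1)) =
          QCExtractor.bits J + Real.logb 2 ((Fintype.card N : ℝ) + 1)) ∧
    (∀ _ : Field N,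
      QCExtractor.PairwiseIndependent (QCExtractor.affinePerm : Nˣ × N → Equiv.Perm N) ∧
      QCExtractor.IsStrongQCExtractor e k ε
        (fun i : (Nˣ × N) × Fin (Fintype.card N + 1) =>
          QCExtractor.permUnitary (QCExtractor.affinePerm i.1) * U i.2) ∧
      QCExtractor.bits ((Nˣ × N) × Fin (Fintype.card N + 1)) ≤ 3 * QCExtractor.bits N) := by
  have hm' := hm.trans (min_le_right _ _)
  refine ⟨fun J _ _ _ P hP => ⟨?_, ?_⟩, fun _ => ⟨?_, ?_, ?_⟩⟩
  · exact QCExtractor.isStrongQCExtractor_of_pairwiseIndependent e b hb U hU hε hm' hP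
  · have hJ : (Fintype.card J : ℝ) ≠ 0 := by simp [Fintype.card_ne_zero]
    unfold QCExtractor.bits
    rw [Fintype.card_prod, Fintype.card_fin]
    push_cast
    exact Real.logb_mul hJ (by positivity)
  · exact QCExtractor.pairwiseIndependent_affinePerm
  · exact QCExtractor.isStrongQCExtractor_of_pairwiseIndependent e b hb U hU hε hm'
      QCExtractor.pairwiseIndependent_affinePerm
  · exact QCExtractor.bits_affinePerm_seed_le
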